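/- Let $A$ be a non-zero unital $C^*$-algebra and let $I\subseteq\mathbb{R}$ be an interval (for instance $I=[0,\infty)$). Let $P_A(I)$ denote the set of real-valued continuous functions $f$ on $I$ that are $A$-monotone, i.e. such that for all self-adjoint $x,y\in A$ with spectrum contained in $I$, $x\le y$ implies $f(x)\le f(y)$, where $f(x)$, $f(y)$ are given by the continuous functional calculus and $\le$ is the usual order of $A$ (positivity of the difference). For a positive integer $n$ let $P_n(I)=P_{M_n(\mathbb{C})}(I)$ be the set of matrix monotone functions of order $n$ on $I$. If $A$ is $n$-homogeneous, that is, if every non-zero irreducible representation of $A$ on a Hilbert space is $n$-dimensional, then $$P_A(I)=P_n(I).$$ -/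

import Mathlib

open scoped ComplexOrder

universe u

/-- `P_A(I)`: the real functions, continuous on `I`, such that `x ≤ y` implies `f(x) ≤ f(y)` for all
self-adjoint `x`, `y` in the unital C⋆-algebra `A` with spectrum in `I`. Here `f(x)` is the
continuous functional calculus; only the values of `f` on `I` matter. -/
def monotoneFunctions (A : Type*) [CStarAlgebra A] [PartialOrder A] [StarOrderedRing A]
    (I : Set ℝ) : Set (ℝ → ℝ) :=
  {f | ContinuousOn f I ∧
    ∀ x y : A, IsSelfAdjoint x → IsSelfAdjoint y → spectrum ℝ x ⊆ I → spectrum ℝ y ⊆ I →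
      x ≤ y → cfc f x ≤ cfc f y}

/-- `P_n(I)`: the matrix monotone functions of order `n` on `I`, that is `P_A(I)` for `A` the
C⋆-algebra of complex `n × n` matrices. -/
def matrixMonotoneFunctions (n : ℕ) (I : Set ℝ) : Set (ℝ → ℝ) :=
  monotoneFunctions (CStarMatrix (Fin n) (Fin n) ℂ) I

/-- A representation of `A` on the Hilbert space `H` is irreducible if the only closed invariant
subspaces are `0` and `H`. The zero representation on a space of dimension at most one is
irreducible in this sense. -/
def IsIrreducibleRep {A H : Type*} [CStarAlgebra A] [NormedAddCommGroup H]
    [InnerProductSpace ℂ H] [CompleteSpace H] (π : A →⋆ₙₐ[ℂ] (H →L[ℂ] H)) : Prop :=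
  ∀ K : Submodule ℂ H, IsClosed (K : Set H) → (∀ a : A, ∀ v ∈ K, π a v ∈ K) → K = ⊥ ∨ K = ⊤

/-- `A` is `n`-homogeneous: every non-zero irreducible representation of `A` on a Hilbert space is
`n`-dimensional. The Hilbert space of an irreducible representation is the closure of an orbit of
`A`, so up to unitary equivalence all of them live in the universe of `A`. -/
def IsHomogeneousCStar (n : ℕ) (A : Type u) [CStarAlgebra A] : Prop :=
  ∀ (H : Type u) [NormedAddCommGroup H] [InnerProductSpace ℂ H] [CompleteSpace H]
    (π : A →⋆ₙₐ[ℂ] (H →L[ℂ] H)), π ≠ 0 → IsIrreducibleRep π → Module.rank ℂ H = n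

/-!
A surjective homomorphism `π : A → B` carries monotone functions on `A` to monotone functions on
`B`: a pair `x ≤ y` in `B` with spectra in `[c, d]` lifts to such a pair in `A` when `y - c` is
invertible, because then `x - c` is `(y - c)^(1/2) w (y - c)^(1/2)` for a contraction `w ≥ 0`, and
each of the two factors lifts; the general case follows by continuity of the functional calculus.
Conversely, a function that is monotone on `B` is monotone on `A` as soon as homomorphisms `A → B`
detect positivity. Both apply to an `n`-homogeneous `A` and `B` the `n × n` matrices. Indeed, a
self-adjoint `a ∈ A` which is not positive is negative at some state by Hahn-Banach, hence at a pure
state by Krein-Milman. The GNS representation of that state is irreducible, thus `n`-dimensional,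
thus onto the matrices by Burnside's theorem, and it does not map `a` to a positive matrix.
-/

open scoped CStarAlgebra InnerProductSpace Ring

theorem exists_mem_extremePoints_lt {E : Type*} [AddCommGroup E] [Module ℝ E] [TopologicalSpace E]
    [T2Space E] [IsTopologicalAddGroup E] [ContinuousSMul ℝ E] [LocallyConvexSpace ℝ E]
    {s : Set E} (hs : IsCompact s) (hconv : Convex ℝ s) {f : E → ℝ}
    (hf : IsLinearMap ℝ f) (hfc : Continuous f) {x : E} (hx : x ∈ s) {c : ℝ} (hxc : f x < c) :
    ∃ e ∈ s.extremePoints ℝ, f e < c := by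
  by_contra! h
  have hsub : closure (convexHull ℝ (s.extremePoints ℝ)) ⊆ {y | c ≤ f y} :=
    closure_minimal (convexHull_min h (convex_halfSpace_ge hf c))
      (isClosed_le continuous_const hfc)
  rw [closure_convexHull_extremePoints hs hconv] at hsub
  exact hxc.not_ge (hsub hx)

section GNS

variable {A : Type*} [CStarAlgebra A] [PartialOrder A] [StarOrderedRing A] (φ : A →ₚ[ℂ] ℂ)

/-- The image of the unit in the GNS space, a cyclic vector for the GNS representation. -/
noncomputable def gnsVector : φ.GNS := (φ.toPreGNS 1 : φ.GNS)

theorem gnsStarAlgHom_gnsVector (x : A) :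
    φ.gnsStarAlgHom x (gnsVector φ) = (φ.toPreGNS x : φ.GNS) := by
  change φ.gnsNonUnitalStarAlgHom x (φ.toPreGNS 1 : φ.GNS) = _
  rw [PositiveLinearMap.gnsNonUnitalStarAlgHom_apply_coe]
  simp

theorem inner_gnsVector (x : A) :
    ⟪gnsVector φ, φ.gnsStarAlgHom x (gnsVector φ)⟫_ℂ = φ x := by
  rw [gnsStarAlgHom_gnsVector, gnsVector, UniformSpace.Completion.inner_coe,
    PositiveLinearMap.preGNS_inner_def]
  simp

theorem denseRange_gnsStarAlgHom_gnsVector :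
    DenseRange fun x : A ↦ φ.gnsStarAlgHom x (gnsVector φ) := by
  simp only [gnsStarAlgHom_gnsVector]
  exact (UniformSpace.Completion.denseRange_coe (α := φ.PreGNS)).comp
    φ.toPreGNS.surjective.denseRange (UniformSpace.Completion.continuous_coe _)

theorem norm_gnsVector_mul_self : ‖gnsVector φ‖ * ‖gnsVector φ‖ = ‖φ 1‖ := by
  rw [← inner_gnsVector, map_one, one_apply_eq_self, inner_self_eq_norm_sq_to_K, ← sq]
  simp

theorem norm_apply_le_norm_apply_one_mul_norm (x : A) : ‖φ x‖ ≤ ‖φ 1‖ * ‖x‖ := by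
  have hπ : ‖φ.gnsStarAlgHom x‖ ≤ ‖x‖ := NonUnitalStarAlgHom.norm_apply_le φ.gnsStarAlgHom x
  calc ‖φ x‖ = ‖⟪gnsVector φ, φ.gnsStarAlgHom x (gnsVector φ)⟫_ℂ‖ := by rw [inner_gnsVector]
    _ ≤ ‖gnsVector φ‖ * (‖x‖ * ‖gnsVector φ‖) :=
      (norm_inner_le_norm _ _).trans <|
        mul_le_mul_of_nonneg_left (ContinuousLinearMap.le_of_opNorm_le _ hπ _) (norm_nonneg _)
    _ = ‖φ 1‖ * ‖x‖ := by rw [← norm_gnsVector_mul_self]; ring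

end GNS

/-- Positivity of a functional in the dual of a C⋆-algebra, as a predicate on the weak-⋆ dual so
that convexity and compactness of sets of positive functionals can be expressed. -/
def IsPositiveFunctional {A : Type*} [CStarAlgebra A] [PartialOrder A] (φ : WeakDual ℂ A) : Prop :=
  ∀ x, 0 ≤ x → 0 ≤ φ x

/-- The states of a unital C⋆-algebra: the positive functionals with value `1` at the unit, as a
convex and weak-⋆ compact subset of the dual. -/
def stateSpace (A : Type*) [CStarAlgebra A] [PartialOrder A] : Set (WeakDual ℂ A) :=
  {φ | φ 1 = 1 ∧ IsPositiveFunctional φ}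

/-- The pure states of a unital C⋆-algebra, defined as the extreme points of its state space; their
GNS representations are irreducible. -/
def pureStates (A : Type*) [CStarAlgebra A] [PartialOrder A] : Set (WeakDual ℂ A) :=
  (stateSpace A).extremePoints ℝ

theorem convex_stateSpace (A : Type*) [CStarAlgebra A] [PartialOrder A] :
    Convex ℝ (stateSpace A) := by
  rintro φ ⟨hφ1, hφ⟩ ψ ⟨hψ1, hψ⟩ s t hs ht hst
  refine ⟨?_, fun x hx ↦ add_nonneg (smul_nonneg hs (hφ x hx)) (smul_nonneg ht (hψ x hx))⟩
  change s • φ 1 + t • ψ 1 = 1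
  rw [hφ1, hψ1, ← add_smul, hst, one_smul]

section States

variable {A : Type*} [CStarAlgebra A] [PartialOrder A] [StarOrderedRing A]

namespace IsPositiveFunctional

variable {φ : WeakDual ℂ A} (hφ : IsPositiveFunctional φ)

/-- A positive functional as a bundled positive linear map, the input of the GNS construction. -/
noncomputable def toPositiveLinearMap : A →ₚ[ℂ] ℂ := .mk₀ (WeakDual.toStrongDual φ).toLinearMap hφ

include hφ

theorem norm_apply_le (x : A) : ‖φ x‖ ≤ ‖φ 1‖ * ‖x‖ :=
  norm_apply_le_norm_apply_one_mul_norm hφ.toPositiveLinearMap x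

theorem re_apply_one_pos (hφ0 : φ ≠ 0) : 0 < (φ 1).re := by
  have h1 : 0 ≤ φ 1 := hφ 1 zero_le_one
  have hne : φ 1 ≠ 0 := fun h ↦ hφ0 <| DFunLike.ext _ _ fun x ↦
    norm_le_zero_iff.1 ((hφ.norm_apply_le x).trans_eq (by rw [h, norm_zero, zero_mul]))
  exact (Complex.pos_iff.1 (h1.lt_of_ne' hne)).1

theorem inv_re_smul_mem_stateSpace (hφ0 : φ ≠ 0) : (φ 1).re⁻¹ • φ ∈ stateSpace A := by
  have hpos := hφ.re_apply_one_pos hφ0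
  refine ⟨?_, fun x hx ↦ smul_nonneg (inv_nonneg.2 hpos.le) (hφ x hx)⟩
  change (φ 1).re⁻¹ • φ 1 = 1
  rw [inv_smul_eq_iff₀ hpos.ne']
  exact Complex.ext (by simp) (by simp [← (Complex.nonneg_iff.1 (hφ 1 zero_le_one)).2])

end IsPositiveFunctional

theorem isCompact_stateSpace : IsCompact (stateSpace A) := by
  refine (WeakDual.isCompact_closedBall (𝕜 := ℂ) (E := A) 0 1).of_isClosed_subset ?_ ?_
  · have hinter : stateSpace A = {φ | φ 1 = 1} ∩ ⋂ x : A, ⋂ _ : 0 ≤ x, {φ | 0 ≤ φ x} := by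
      ext φ
      simp [stateSpace, IsPositiveFunctional]
    rw [hinter]
    exact (isClosed_eq (WeakDual.eval_continuous 1) continuous_const).inter
      (isClosed_iInter fun x ↦ isClosed_iInter fun _ ↦
        isClosed_le continuous_const (WeakDual.eval_continuous x))
  · rintro φ ⟨hφ1, hφ⟩
    rw [Set.mem_preimage, mem_closedBall_zero_iff]
    exact ContinuousLinearMap.opNorm_le_bound _ zero_le_one fun x ↦
      (hφ.norm_apply_le x).trans_eq (by rw [hφ1, norm_one])

theorem exists_isPositiveFunctional_re_neg {a : A} (ha : IsSelfAdjoint a) (h : ¬ 0 ≤ a) :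
    ∃ φ : WeakDual ℂ A, IsPositiveFunctional φ ∧ (φ a).re < 0 := by
  -- `C` is the set of `x` with positive real part. It contains `±i x` for `x` self-adjoint, which
  -- makes the complexification of a real functional that is nonnegative on `C` positive.
  let C : ProperCone ℝ A := (ProperCone.positive ℝ A).comap
    (.id ℝ A + ((starL' ℝ : A ≃L[ℝ] A) : A →L[ℝ] A))
  have hC : ∀ x, x ∈ C ↔ 0 ≤ x + star x := fun _ ↦ Iff.rfl
  have haC : a ∉ C := by
    rwa [hC, ha.star_eq, ← two_nsmul, ← Nat.cast_smul_eq_nsmul ℝ,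
      smul_nonneg_iff_nonneg_of_pos_left (by norm_num)]
  obtain ⟨f, hf, hfa⟩ := ProperCone.hyperplane_separation_point C haC
  refine ⟨StrongDual.toWeakDual (StrongDual.extendRCLike f), fun x hx ↦ ?_, ?_⟩
  · have hxC : x ∈ C := (hC x).2 (add_nonneg hx (star_nonneg_iff.2 hx))
    have hIxC : Complex.I • x ∈ C ∧ -(Complex.I • x) ∈ C := by
      simp [hC, (IsSelfAdjoint.of_nonneg hx).star_eq]
    have hfIx : f (Complex.I • x) = 0 :=
      le_antisymm (by simpa using hf _ hIxC.2) (hf _ hIxC.1)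
    refine Complex.nonneg_iff.2 ⟨?_, ?_⟩
    · exact (hf x hxC).trans_eq (StrongDual.re_extendRCLike_apply (𝕜 := ℂ) f x).symm
    · exact ((StrongDual.im_extendRCLike_apply (𝕜 := ℂ) f x).trans (neg_eq_zero.2 hfIx)).symm
  · exact (StrongDual.re_extendRCLike_apply (𝕜 := ℂ) f a).trans_lt hfa

theorem exists_mem_stateSpace_re_neg {a : A} (ha : IsSelfAdjoint a) (h : ¬ 0 ≤ a) :
    ∃ φ ∈ stateSpace A, (φ a).re < 0 := by
  obtain ⟨φ, hφ, hφa⟩ := exists_isPositiveFunctional_re_neg ha h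
  have hφ0 : φ ≠ 0 := by
    rintro rfl
    exact hφa.false
  refine ⟨(φ 1).re⁻¹ • φ, hφ.inv_re_smul_mem_stateSpace hφ0, ?_⟩
  change ((φ 1).re⁻¹ • φ a).re < 0
  rw [Complex.smul_re]
  exact mul_neg_of_pos_of_neg (inv_pos.2 (hφ.re_apply_one_pos hφ0)) hφa

theorem exists_mem_pureStates_re_neg {a : A} (ha : IsSelfAdjoint a) (h : ¬ 0 ≤ a) :
    ∃ φ ∈ pureStates A, (φ a).re < 0 := by
  have hlc : LocallyConvexSpace ℝ (WeakDual ℂ A) :=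
    inferInstanceAs (LocallyConvexSpace ℝ (WeakBilin (topDualPairing ℂ A)))
  obtain ⟨φ, hφ, hφa⟩ := exists_mem_stateSpace_re_neg ha h
  have hlin : IsLinearMap ℝ fun ψ : WeakDual ℂ A ↦ (ψ a).re :=
    ⟨fun _ _ ↦ rfl, fun r ψ ↦ Complex.smul_re r (ψ a)⟩
  -- The two routes to the real action on `WeakDual ℂ A` agree only by unfolding, so instance search
  -- cannot supply its continuity.
  exact @exists_mem_extremePoints_lt (WeakDual ℂ A) _ _ _ _ _ (WeakDual.instContinuousSMul ℝ) hlc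
    _ isCompact_stateSpace (convex_stateSpace A) _ hlin
    (Complex.continuous_re.comp (WeakDual.eval_continuous a)) φ hφ 0 hφa

theorem eq_smul_of_add_mem_pureStates {φ ψ : WeakDual ℂ A} (hφ : IsPositiveFunctional φ)
    (hψ : IsPositiveFunctional ψ) (h : φ + ψ ∈ pureStates A) : φ = (φ 1).re • (φ + ψ) := by
  have h1 : (φ 1).re + (ψ 1).re = 1 := congrArg Complex.re h.1.1
  rcases eq_or_ne φ 0 with rfl | hφ0
  · exact (zero_smul ℝ (0 + ψ)).symm
  rcases eq_or_ne ψ 0 with rfl | hψ0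
  · have hφ1 : (φ 1).re = 1 := (add_zero _).symm.trans h1
    rw [hφ1, add_zero]
    exact (one_smul ℝ φ).symm
  have hφ1 := hφ.re_apply_one_pos hφ0
  have hψ1 := hψ.re_apply_one_pos hψ0
  have hseg : φ + ψ ∈ openSegment ℝ ((φ 1).re⁻¹ • φ) ((ψ 1).re⁻¹ • ψ) :=
    ⟨(φ 1).re, (ψ 1).re, hφ1, hψ1, h1,
      congrArg₂ (· + ·) (smul_inv_smul₀ hφ1.ne' φ) (smul_inv_smul₀ hψ1.ne' ψ)⟩
  rw [← h.2 (hφ.inv_re_smul_mem_stateSpace hφ0) (hψ.inv_re_smul_mem_stateSpace hψ0) hseg]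
  exact (smul_inv_smul₀ hφ1.ne' φ).symm

end States

section Projection

variable {𝕜 H : Type*} [RCLike 𝕜] [NormedAddCommGroup H] [InnerProductSpace 𝕜 H]

theorem eq_bot_or_eq_top_of_starProjection_eq_smul {K : Submodule 𝕜 H}
    [K.HasOrthogonalProjection] {c : 𝕜} (h : ∀ v, K.starProjection v = c • v) :
    K = ⊥ ∨ K = ⊤ := by
  rcases eq_or_ne c 0 with rfl | hc
  · left
    refine (Submodule.eq_bot_iff _).2 fun v hv ↦ ?_
    rw [← Submodule.starProjection_eq_self_iff.2 hv, h, zero_smul]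
  · right
    refine Submodule.eq_top_iff'.2 fun v ↦ ?_
    rw [← K.smul_mem_iff hc, ← h]
    exact K.starProjection_apply_mem v

end Projection

section Representations

variable {A H : Type*} [CStarAlgebra A] [NormedAddCommGroup H] [InnerProductSpace ℂ H]
  [CompleteSpace H] (π : A →⋆ₐ[ℂ] (H →L[ℂ] H))

/-- The functional `x ↦ ⟪v, π x v⟫` defined by a vector `v` in a representation `π`. For cyclic `v`
its purity forces `π` to be irreducible. -/
noncomputable def vectorFunctional (v : H) : WeakDual ℂ A :=
  StrongDual.toWeakDual <|
    (innerSL ℂ v ∘L ContinuousLinearMap.apply ℂ H v) ∘L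
      ⟨π.toAlgHom.toLinearMap, map_continuous π⟩

theorem vectorFunctional_apply (v : H) (x : A) : vectorFunctional π v x = ⟪v, π x v⟫_ℂ := rfl

theorem isPositiveFunctional_vectorFunctional [PartialOrder A] [StarOrderedRing A] (v : H) :
    IsPositiveFunctional (vectorFunctional π v) := fun _ hx ↦
  ((ContinuousLinearMap.nonneg_iff_isPositive _).1 (map_nonneg π hx)).inner_nonneg_right v

theorem inner_rep_left (x : A) (v w : H) : ⟪π x v, w⟫_ℂ = ⟪v, π (star x) w⟫_ℂ := by
  rw [map_star, ContinuousLinearMap.star_eq_adjoint, ContinuousLinearMap.adjoint_inner_right]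

variable {π}

section InvariantSubspace

variable {K : Submodule ℂ H} [K.HasOrthogonalProjection] (hK : ∀ a : A, ∀ v ∈ K, π a v ∈ K)
include hK

theorem starProjection_rep_apply (x : A) (v : H) :
    K.starProjection (π x v) = π x (K.starProjection v) := by
  refine (Submodule.eq_starProjection_of_mem_of_inner_eq_zero
    (hK x _ (K.starProjection_apply_mem v)) fun w hw ↦ ?_)
  rw [← map_sub, inner_rep_left]
  exact Submodule.starProjection_inner_eq_zero v _ (hK _ w hw)

theorem inner_starProjection_rep_starProjection (x : A) (v w : H) :
    ⟪K.starProjection v, π x (K.starProjection w)⟫_ℂ = ⟪K.starProjection v, π x w⟫_ℂ := by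
  rw [← starProjection_rep_apply hK, ← Submodule.inner_starProjection_left_eq_right,
    Submodule.starProjection_eq_self_iff.2 (K.starProjection_apply_mem v)]

theorem vectorFunctional_starProjection_add (v : H) :
    vectorFunctional π (K.starProjection v) + vectorFunctional π (v - K.starProjection v) =
      vectorFunctional π v := by
  refine DFunLike.ext _ _ fun x ↦ ?_
  change ⟪_, π x _⟫_ℂ + ⟪_, π x _⟫_ℂ = ⟪v, π x v⟫_ℂ
  have hleft : ⟪v, π x (K.starProjection v)⟫_ℂ = ⟪K.starProjection v, π x v⟫_ℂ := by
    rw [← starProjection_rep_apply hK, ← Submodule.inner_starProjection_left_eq_right]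
  simp only [map_sub, inner_sub_left, inner_sub_right, inner_starProjection_rep_starProjection hK,
    hleft]
  ring

theorem starProjection_eq_smul_of_denseRange {ξ : H} (hξ : DenseRange fun x : A ↦ π x ξ) {c : ℂ}
    (hc : ∀ x, ⟪K.starProjection ξ, π x ξ⟫_ℂ = ⟪c • ξ, π x ξ⟫_ℂ) (v : H) :
    K.starProjection v = c • v := by
  have hPξ : K.starProjection ξ = c • ξ := hξ.eq_of_inner_left ℂ hc
  have heq : K.starProjection ∘ (fun x : A ↦ π x ξ) = (c • ·) ∘ fun x : A ↦ π x ξ := by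
    ext x
    simp only [Function.comp_apply, starProjection_rep_apply hK, hPξ, map_smul]
  exact congrFun (hξ.equalizer K.starProjection.continuous (continuous_const_smul c) heq) v

end InvariantSubspace

theorem isIrreducibleRep_of_vectorFunctional_mem_pureStates [PartialOrder A] [StarOrderedRing A]
    {ξ : H} (hξ : DenseRange fun x : A ↦ π x ξ) (hpure : vectorFunctional π ξ ∈ pureStates A) :
    IsIrreducibleRep (π : A →⋆ₙₐ[ℂ] (H →L[ℂ] H)) := by
  intro K hKclosed hK
  replace hK : ∀ a : A, ∀ v ∈ K, π a v ∈ K := hK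
  have : CompleteSpace K := hKclosed.completeSpace_coe
  have hsum := vectorFunctional_starProjection_add hK ξ
  rw [← hsum] at hpure
  have hdom := eq_smul_of_add_mem_pureStates (isPositiveFunctional_vectorFunctional π _)
    (isPositiveFunctional_vectorFunctional π _) hpure
  rw [hsum] at hdom
  set c := (vectorFunctional π (K.starProjection ξ) 1).re
  refine eq_bot_or_eq_top_of_starProjection_eq_smul
    (starProjection_eq_smul_of_denseRange hK hξ (c := c) fun x ↦ ?_)
  calc ⟪K.starProjection ξ, π x ξ⟫_ℂ = vectorFunctional π (K.starProjection ξ) x :=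
      (inner_starProjection_rep_starProjection hK x ξ ξ).symm
    _ = c • ⟪ξ, π x ξ⟫_ℂ := DFunLike.congr_fun hdom x
    _ = ⟪(c : ℂ) • ξ, π x ξ⟫_ℂ := by simp

end Representations

section PureStates

variable {A : Type*} [CStarAlgebra A] [PartialOrder A] [StarOrderedRing A]

theorem vectorFunctional_gnsVector {φ : WeakDual ℂ A} (hφ : IsPositiveFunctional φ) :
    vectorFunctional hφ.toPositiveLinearMap.gnsStarAlgHom (gnsVector hφ.toPositiveLinearMap) = φ :=
  DFunLike.ext _ _ fun x ↦ inner_gnsVector hφ.toPositiveLinearMap x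

theorem isIrreducibleRep_gnsStarAlgHom {φ : WeakDual ℂ A} (hφ : φ ∈ pureStates A) :
    IsIrreducibleRep (hφ.1.2.toPositiveLinearMap.gnsStarAlgHom :
      A →⋆ₙₐ[ℂ] (hφ.1.2.toPositiveLinearMap.GNS →L[ℂ] hφ.1.2.toPositiveLinearMap.GNS)) :=
  isIrreducibleRep_of_vectorFunctional_mem_pureStates
    (denseRange_gnsStarAlgHom_gnsVector _) (by rwa [vectorFunctional_gnsVector])

theorem nontrivial_gns {φ : WeakDual ℂ A} (hφ : φ ∈ stateSpace A) :
    Nontrivial hφ.2.toPositiveLinearMap.GNS := by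
  refine nontrivial_of_ne (gnsVector hφ.2.toPositiveLinearMap) 0 fun h0 ↦ one_ne_zero (α := ℂ) ?_
  rw [← hφ.1, ← vectorFunctional_gnsVector hφ.2, vectorFunctional_apply, h0, inner_zero_left]

end PureStates

theorem exists_isIrreducibleRep_not_nonneg {A : Type u} [CStarAlgebra A] [PartialOrder A]
    [StarOrderedRing A] {a : A} (ha : IsSelfAdjoint a) (h : ¬ 0 ≤ a) :
    ∃ (H : Type u) (_ : NormedAddCommGroup H) (_ : InnerProductSpace ℂ H) (_ : CompleteSpace H)
      (π : A →⋆ₐ[ℂ] (H →L[ℂ] H)), Nontrivial H ∧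
        IsIrreducibleRep (π : A →⋆ₙₐ[ℂ] (H →L[ℂ] H)) ∧ ¬ 0 ≤ π a := by
  obtain ⟨φ, hφ, hφa⟩ := exists_mem_pureStates_re_neg ha h
  refine ⟨_, _, _, inferInstance, hφ.1.2.toPositiveLinearMap.gnsStarAlgHom, nontrivial_gns hφ.1,
    isIrreducibleRep_gnsStarAlgHom hφ, fun hpos ↦ hφa.not_ge ?_⟩
  rw [← vectorFunctional_gnsVector hφ.1.2]
  exact ((ContinuousLinearMap.nonneg_iff_isPositive _).1 hpos).re_inner_nonneg_right _

theorem IsIrreducibleRep.surjective {A H : Type*} [CStarAlgebra A] [NormedAddCommGroup H]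
    [InnerProductSpace ℂ H] [CompleteSpace H] [FiniteDimensional ℂ H] [Nontrivial H]
    {π : A →⋆ₐ[ℂ] (H →L[ℂ] H)} (hπ : IsIrreducibleRep (π : A →⋆ₙₐ[ℂ] (H →L[ℂ] H))) :
    Function.Surjective π := by
  let : Module A H := Module.compHom H
    ((ContinuousLinearMap.toLinearMapRingHom (R₁ := ℂ) (M₁ := H)).comp (π : A →+* (H →L[ℂ] H)))
  have hsmul (a : A) (v : H) : a • v = π a v := rfl
  have : IsScalarTower ℂ A H := ⟨fun c a v ↦ by simp only [hsmul, map_smul, smul_apply]⟩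
  have : IsSimpleModule A H :=
    { exists_pair_ne := ⟨⊥, ⊤, bot_ne_top⟩
      eq_bot_or_eq_top := fun N ↦ by
        simpa using hπ (N.restrictScalars ℂ) (Submodule.closed_of_finiteDimensional _)
          (fun a _ hv ↦ N.smul_mem a hv) }
  have : Module.Finite (Module.End A H) H := Module.Finite.of_restrictScalars_finite ℂ _ _
  have hschur := IsSimpleModule.algebraMap_end_bijective_of_isAlgClosed (A := A) (V := H) ℂ
  intro T
  let f : Module.End (Module.End A H) H :=
    { toFun := T
      map_add' := map_add T
      map_smul' := fun e v ↦ by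
        obtain ⟨c, rfl⟩ := hschur.2 e
        simp }
  obtain ⟨a, ha⟩ := Module.Finite.toModuleEnd_moduleEnd_surjective (R := A) f
  exact ⟨a, ContinuousLinearMap.ext fun v ↦ LinearMap.congr_fun ha v⟩

/-- The matrix picture of the operators on a finite-dimensional Hilbert space, relative to an
orthonormal basis, as an isomorphism of C⋆-algebras. -/
noncomputable def operatorEquivCStarMatrix {ι H : Type*} [Fintype ι] [DecidableEq ι]
    [NormedAddCommGroup H] [InnerProductSpace ℂ H] [CompleteSpace H]
    (b : OrthonormalBasis ι ℂ H) : (H →L[ℂ] H) ≃⋆ₐ[ℂ] CStarMatrix ι ι ℂ :=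
  b.repr.conjStarAlgEquiv.trans
    (Matrix.toEuclideanCLM.symm.trans CStarMatrix.ofMatrixStarAlgEquiv)

theorem IsHomogeneousCStar.exists_surjective_not_nonneg {A : Type u} [CStarAlgebra A]
    [PartialOrder A] [StarOrderedRing A] {n : ℕ} (hA : IsHomogeneousCStar n A) {a : A}
    (ha : IsSelfAdjoint a) (h : ¬ 0 ≤ a) :
    ∃ ρ : A →⋆ₐ[ℂ] CStarMatrix (Fin n) (Fin n) ℂ, Function.Surjective ρ ∧ ¬ 0 ≤ ρ a := by
  obtain ⟨H, _, _, _, π, _, hirr, hneg⟩ := exists_isIrreducibleRep_not_nonneg ha h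
  have hne : (π : A →⋆ₙₐ[ℂ] (H →L[ℂ] H)) ≠ 0 := fun h0 ↦
    one_ne_zero ((map_one π).symm.trans (DFunLike.congr_fun h0 1))
  have hrank : Module.rank ℂ H = n := hA H _ hne hirr
  have : FiniteDimensional ℂ H :=
    Module.rank_lt_aleph0_iff.1 (hrank ▸ Cardinal.natCast_lt_aleph0)
  let e := operatorEquivCStarMatrix ((stdOrthonormalBasis ℂ H).reindex
    (finCongr (Module.finrank_eq_of_rank_eq hrank)))
  refine ⟨(e : (H →L[ℂ] H) →⋆ₐ[ℂ] CStarMatrix (Fin n) (Fin n) ℂ).comp π,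
    e.surjective.comp hirr.surjective, fun hpos ↦ hneg ?_⟩
  rw [← e.symm_apply_apply (π a)]
  exact map_nonneg e.symm hpos

section OrderIntervals

variable {B : Type*} [CStarAlgebra B] [PartialOrder B] [StarOrderedRing B] {c d : ℝ}

theorem spectrum_subset_Icc_iff {x : B} (hx : IsSelfAdjoint x) :
    spectrum ℝ x ⊆ Set.Icc c d ↔ x ∈ Set.Icc (algebraMap ℝ B c) (algebraMap ℝ B d) := by
  rw [Set.mem_Icc, algebraMap_le_iff_le_spectrum hx, le_algebraMap_iff_spectrum_le hx]
  exact forall₂_and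

theorem isSelfAdjoint_of_algebraMap_le {x : B} (h : algebraMap ℝ B c ≤ x) : IsSelfAdjoint x :=
  .of_ge h (.algebraMap B (.all c))

theorem exists_Icc_subset_of_spectrum_subset [Nontrivial B] {I : Set ℝ} (hI : I.OrdConnected)
    {x y : B} (hx : IsSelfAdjoint x) (hy : IsSelfAdjoint y) (hxI : spectrum ℝ x ⊆ I)
    (hyI : spectrum ℝ y ⊆ I) :
    ∃ c d : ℝ, Set.Icc c d ⊆ I ∧ algebraMap ℝ B c ≤ x ∧ y ≤ algebraMap ℝ B d := by
  obtain ⟨c, hc, hcx⟩ := (ContinuousFunctionalCalculus.isCompact_spectrum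
    (R := ℝ) x).exists_isLeast (ContinuousFunctionalCalculus.spectrum_nonempty x hx)
  obtain ⟨d, hd, hdy⟩ := (ContinuousFunctionalCalculus.isCompact_spectrum
    (R := ℝ) y).exists_isGreatest (ContinuousFunctionalCalculus.spectrum_nonempty y hy)
  exact ⟨c, d, hI.out (hxI hc) (hyI hd), algebraMap_le_of_le_spectrum fun _ ht ↦ hcx ht,
    le_algebraMap_of_spectrum_le fun _ ht ↦ hdy ht⟩

theorem isUnit_lineMap_sub_algebraMap {y : B} (hcy : algebraMap ℝ B c ≤ y) (hcd : c < d) {ε : ℝ}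
    (hε : ε ∈ Set.Ioc 0 1) :
    IsUnit (AffineMap.lineMap y (algebraMap ℝ B d) ε - algebraMap ℝ B c) := by
  have heq : AffineMap.lineMap y (algebraMap ℝ B d) ε - algebraMap ℝ B c =
      (1 - ε) • (y - algebraMap ℝ B c) + algebraMap ℝ B (ε * (d - c)) := by
    simp only [AffineMap.lineMap_apply_module, Algebra.algebraMap_eq_smul_one]
    module
  refine CStarAlgebra.isUnit_of_le _ ?_
    (isStrictlyPositive_algebraMap (mul_pos hε.1 (sub_pos.2 hcd)))
  rw [heq]
  exact le_add_of_nonneg_left (smul_nonneg (sub_nonneg.2 hε.2) (sub_nonneg.2 hcy))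

end OrderIntervals

section StarAlgHom

variable {A B : Type*} [CStarAlgebra A] [CStarAlgebra B]

theorem map_cfc_of_isSelfAdjoint (π : A →⋆ₐ[ℂ] B) {f : ℝ → ℝ} {x : A} (hx : IsSelfAdjoint x)
    (hf : ContinuousOn f (spectrum ℝ x)) : π (cfc f x) = cfc f (π x) :=
  StarAlgHom.map_cfc π f x hf (map_continuous π) hx (hx.map π)

theorem exists_isSelfAdjoint_map_eq {π : A →⋆ₐ[ℂ] B} (hπ : Function.Surjective π) {y : B}
    (hy : IsSelfAdjoint y) : ∃ x : A, IsSelfAdjoint x ∧ π x = y := by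
  obtain ⟨z, rfl⟩ := hπ y
  exact ⟨realPart z, (realPart z).2, by rw [map_realPart, hy.coe_realPart]⟩

variable [PartialOrder A] [StarOrderedRing A] [PartialOrder B] [StarOrderedRing B]

theorem map_conjSqrt (π : A →⋆ₐ[ℂ] B) {c : A} (hc : 0 ≤ c) (x : A) :
    π (CFC.conjSqrt c x) = CFC.conjSqrt (π c) (π x) := by
  have hsqrt : CFC.sqrt (π c) = π (CFC.sqrt c) :=
    CFC.sqrt_unique (by rw [← map_mul, CFC.sqrt_mul_sqrt_self c])
      (map_nonneg π (CFC.sqrt_nonneg c))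
  simp only [CFC.conjSqrt_apply, map_mul, hsqrt]

section Lift

variable {π : A →⋆ₐ[ℂ] B} (hπ : Function.Surjective π)
include hπ

theorem exists_mem_Icc_map_eq {c d : ℝ} (hcd : c ≤ d) {y : B}
    (hy : y ∈ Set.Icc (algebraMap ℝ B c) (algebraMap ℝ B d)) :
    ∃ x ∈ Set.Icc (algebraMap ℝ A c) (algebraMap ℝ A d), π x = y := by
  have hysa := isSelfAdjoint_of_algebraMap_le hy.1
  have hspec : ∀ t ∈ spectrum ℝ y, max c (min d t) = t := fun t ht ↦ by
    obtain ⟨hct, htd⟩ := (spectrum_subset_Icc_iff hysa).2 hy ht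
    rw [min_eq_right htd, max_eq_right hct]
  obtain ⟨w, hw, rfl⟩ := exists_isSelfAdjoint_map_eq hπ hysa
  have hcont : Continuous fun t ↦ max c (min d t) := by fun_prop
  refine ⟨cfc (fun t ↦ max c (min d t)) w, ⟨?_, ?_⟩, ?_⟩
  · exact algebraMap_le_cfc _ _ _ fun t _ ↦ le_max_left _ _
  · exact cfc_le_algebraMap _ _ _ fun t _ ↦ max_le hcd (min_le_left _ _)
  · rw [map_cfc_of_isSelfAdjoint π hw hcont.continuousOn, cfc_congr hspec, cfc_id' ℝ (π w)]

theorem exists_le_map_eq_of_isUnit {x : B} {Y : A} (hY : 0 ≤ Y) (hx : 0 ≤ x) (hxY : x ≤ π Y)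
    (hunit : IsUnit (π Y)) : ∃ X, 0 ≤ X ∧ X ≤ Y ∧ π X = x := by
  have hpos : IsStrictlyPositive (π Y) := hunit.isStrictlyPositive (map_nonneg π hY)
  have hw : CFC.conjSqrt (π Y)⁻¹ʳ x ∈ Set.Icc (algebraMap ℝ B 0) (algebraMap ℝ B 1) := by
    rw [map_zero, map_one, ← map_zero (CFC.conjSqrt (π Y)⁻¹ʳ),
      ← CFC.conjSqrt_ringInverse_self (π Y)]
    exact ⟨CFC.conjSqrt_le_conjSqrt hx, CFC.conjSqrt_le_conjSqrt hxY⟩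
  obtain ⟨W, ⟨hW0, hW1⟩, hπW⟩ := exists_mem_Icc_map_eq hπ zero_le_one hw
  rw [map_zero] at hW0
  rw [map_one] at hW1
  refine ⟨CFC.conjSqrt Y W, ?_, ?_, ?_⟩
  · simpa only [map_zero] using CFC.conjSqrt_le_conjSqrt (c := Y) hW0
  · simpa only [CFC.conjSqrt_one Y] using CFC.conjSqrt_le_conjSqrt (c := Y) hW1
  · rw [map_conjSqrt π hY, hπW, CFC.conjSqrt_conjSqrt_ringInverse _ _ hpos]

theorem exists_le_mem_Icc_map_eq {c d : ℝ} (hcd : c ≤ d) {x y : B} (hcx : algebraMap ℝ B c ≤ x)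
    (hxy : x ≤ y) (hyd : y ≤ algebraMap ℝ B d) (hunit : IsUnit (y - algebraMap ℝ B c)) :
    ∃ X ∈ Set.Icc (algebraMap ℝ A c) (algebraMap ℝ A d),
      ∃ Y ∈ Set.Icc (algebraMap ℝ A c) (algebraMap ℝ A d), X ≤ Y ∧ π X = x ∧ π Y = y := by
  obtain ⟨Y, hY, rfl⟩ := exists_mem_Icc_map_eq hπ hcd ⟨hcx.trans hxy, hyd⟩
  have hπc : π (algebraMap ℝ A c) = algebraMap ℝ B c := (π.toAlgHom.restrictScalars ℝ).commutes c
  have hsub : π (Y - algebraMap ℝ A c) = π Y - algebraMap ℝ B c := by rw [map_sub, hπc]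
  obtain ⟨X, hX0, hXY, hπX⟩ := exists_le_map_eq_of_isUnit hπ (sub_nonneg.2 hY.1)
    (sub_nonneg.2 hcx) ((sub_le_sub_right hxy _).trans_eq hsub.symm) (hsub ▸ hunit)
  have hXcY : X + algebraMap ℝ A c ≤ Y := le_sub_iff_add_le.1 hXY
  refine ⟨X + algebraMap ℝ A c, ⟨le_add_of_nonneg_left hX0, hXcY.trans hY.2⟩, Y, hY, hXcY, ?_, rfl⟩
  rw [map_add, hπX, hπc, sub_add_cancel]

section MonotoneFunctions

variable {I : Set ℝ} {f : ℝ → ℝ} (hf : f ∈ monotoneFunctions A I) {c d : ℝ}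
  (hI : Set.Icc c d ⊆ I) {x y : B} (hcx : algebraMap ℝ B c ≤ x) (hxy : x ≤ y)
  (hyd : y ≤ algebraMap ℝ B d)
include hf hI hcx hxy hyd

theorem cfc_le_cfc_of_surjective_of_isUnit (hcd : c ≤ d) (hunit : IsUnit (y - algebraMap ℝ B c)) :
    cfc f x ≤ cfc f y := by
  obtain ⟨X, hX, Y, hY, hXY, rfl, rfl⟩ :=
    exists_le_mem_Icc_map_eq hπ hcd hcx hxy hyd hunit
  have hXsa := isSelfAdjoint_of_algebraMap_le hX.1
  have hYsa := isSelfAdjoint_of_algebraMap_le hY.1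
  have hXI := ((spectrum_subset_Icc_iff hXsa).2 hX).trans hI
  have hYI := ((spectrum_subset_Icc_iff hYsa).2 hY).trans hI
  rw [← map_cfc_of_isSelfAdjoint π hXsa (hf.1.mono hXI),
    ← map_cfc_of_isSelfAdjoint π hYsa (hf.1.mono hYI)]
  exact OrderHomClass.mono π (hf.2 X Y hXsa hYsa hXI hYI hXY)

theorem cfc_le_cfc_of_surjective_of_lt (hcd : c < d) : cfc f x ≤ cfc f y := by
  -- Moving `y` slightly towards `d` makes `y - c` invertible.
  let Z : ℝ → B := AffineMap.lineMap y (algebraMap ℝ B d)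
  have hZ0 : Z 0 = y := AffineMap.lineMap_apply_zero _ _
  have hZ : ∀ ε ∈ Set.Icc (0 : ℝ) 1, Z ε ∈ Set.Icc y (algebraMap ℝ B d) := fun ε hε ↦
    (convex_Icc y _).lineMap_mem (Set.left_mem_Icc.2 hyd) (Set.right_mem_Icc.2 hyd) hε
  have hZspec : ∀ ε ∈ Set.Icc (0 : ℝ) 1, IsSelfAdjoint (Z ε) ∧ spectrum ℝ (Z ε) ⊆ Set.Icc c d :=
    fun ε hε ↦ by
      have hcZ : algebraMap ℝ B c ≤ Z ε := (hcx.trans hxy).trans (hZ ε hε).1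
      have hsa := isSelfAdjoint_of_algebraMap_le hcZ
      exact ⟨hsa, (spectrum_subset_Icc_iff hsa).2 ⟨hcZ, (hZ ε hε).2⟩⟩
  have hle : ∀ ε ∈ Set.Ioc (0 : ℝ) 1, cfc f x ≤ cfc f (Z ε) := fun ε hε ↦
    have hZε := hZ ε (Set.Ioc_subset_Icc_self hε)
    cfc_le_cfc_of_surjective_of_isUnit hπ hf hI hcx (hxy.trans hZε.1) hZε.2 hcd.le
      (isUnit_lineMap_sub_algebraMap (hcx.trans hxy) hcd hε)
  have hcont : ContinuousOn (fun ε ↦ cfc f (Z ε)) (Set.Icc 0 1) :=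
    AffineMap.lineMap_continuous.continuousOn.cfc' isCompact_Icc f
      (fun ε hε ↦ (hZspec ε hε).2) (fun ε hε ↦ (hZspec ε hε).1) (hf.1.mono hI)
  have h0 : (0 : ℝ) ∈ closure (Set.Ioc 0 1) :=
    (closure_Ioc (zero_ne_one' ℝ)).symm ▸ Set.left_mem_Icc.2 zero_le_one
  simpa only [hZ0] using ContinuousWithinAt.closure_le h0 continuousWithinAt_const
    ((hcont 0 (Set.left_mem_Icc.2 zero_le_one)).mono Set.Ioc_subset_Icc_self) hle

theorem cfc_le_cfc_of_surjective : cfc f x ≤ cfc f y := by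
  nontriviality B
  have hcd : c ≤ d := algebraMap_le_algebraMap.1 ((hcx.trans hxy).trans hyd)
  rcases hcd.eq_or_lt with rfl | hlt
  · rw [le_antisymm (hxy.trans hyd) hcx, le_antisymm hyd (hcx.trans hxy)]
  · exact cfc_le_cfc_of_surjective_of_lt hπ hf hI hcx hxy hyd hlt

end MonotoneFunctions

theorem monotoneFunctions_subset_of_surjective {I : Set ℝ} (hI : I.OrdConnected) :
    monotoneFunctions A I ⊆ monotoneFunctions B I := by
  intro f hf
  refine ⟨hf.1, fun x y hx hy hxI hyI hxy ↦ ?_⟩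
  nontriviality B
  obtain ⟨c, d, hcdI, hcx, hyd⟩ := exists_Icc_subset_of_spectrum_subset hI hx hy hxI hyI
  exact cfc_le_cfc_of_surjective hπ hf hcdI hcx hxy hyd

end Lift

end StarAlgHom

theorem monotoneFunctions_subset_of_separating {A B : Type*} [CStarAlgebra A] [PartialOrder A]
    [StarOrderedRing A] [CStarAlgebra B] [PartialOrder B] [StarOrderedRing B]
    (hsep : ∀ a : A, IsSelfAdjoint a → (∀ ρ : A →⋆ₐ[ℂ] B, 0 ≤ ρ a) → 0 ≤ a) (I : Set ℝ) :
    monotoneFunctions B I ⊆ monotoneFunctions A I := by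
  intro f hf
  refine ⟨hf.1, fun x y hx hy hxI hyI hxy ↦ sub_nonneg.1 <|
    hsep _ ((cfc_predicate f y).sub (cfc_predicate f x)) fun ρ ↦ ?_⟩
  have hspec (z : A) : spectrum ℝ (ρ z) ⊆ spectrum ℝ z :=
    AlgHom.spectrum_apply_subset (ρ.toAlgHom.restrictScalars ℝ) z
  rw [map_sub, sub_nonneg, map_cfc_of_isSelfAdjoint ρ hx (hf.1.mono hxI),
    map_cfc_of_isSelfAdjoint ρ hy (hf.1.mono hyI)]
  exact hf.2 _ _ (hx.map ρ) (hy.map ρ) ((hspec x).trans hxI) ((hspec y).trans hyI)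
    (OrderHomClass.mono ρ hxy)

theorem corollary2p7 {A : Type u} [CStarAlgebra A] [PartialOrder A] [StarOrderedRing A]
    [Nontrivial A] (n : ℕ) (hn : 0 < n) (hA : IsHomogeneousCStar n A)
    (I : Set ℝ) (hI : I.OrdConnected) :
    monotoneFunctions A I = matrixMonotoneFunctions n I := by
  have hneg : ¬ (0 : A) ≤ -1 := fun h ↦ zero_lt_one.not_ge (neg_nonneg.1 h)
  obtain ⟨ρ, hρ, -⟩ := hA.exists_surjective_not_nonneg (IsSelfAdjoint.one A).neg hneg
  refine (monotoneFunctions_subset_of_surjective hρ hI).antisymm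
    (monotoneFunctions_subset_of_separating (fun a ha hpos ↦ ?_) I)
  by_contra hneg
  obtain ⟨σ, -, hσ⟩ := hA.exists_surjective_not_nonneg ha hneg
  exact hσ (hpos σ)
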